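/- Fix an integer $k \ge 2$ and real numbers $d > 0$ and $\eta \in [-\frac{1}{k-1}, 1]$, not depending on $n$. Consider the following two distributions over graphs on $n$ vertices (defined for all $n$ large enough that the numbers below lie in $[0,1]$). Under the null distribution $\mathbb{Q} = \mathbb{Q}_n$, every edge $(u,v)$, $u<v$, occurs independently with probability $d/n$. Under the planted distribution $\mathbb{P} = \mathbb{P}_n$ (the stochastic block model), each vertex is independently assigned a community label drawn uniformly from $\{1,\dots,k\}$; conditioned on the labels, edges occur independently, the edge $(u,v)$ occurring with probability $(1+(k-1)\eta)\frac{d}{n}$ if $u,v$ have the same label and with probability $(1-\eta)\frac{d}{n}$ otherwise. Let $L = \frac{d\mathbb{P}}{d\mathbb{Q}}$ be the likelihood ratio and, for an integer $D \ge 0$, let $L^{\le D}$ be the orthogonal projection of $L$, in $L^2(\mathbb{Q})$, onto the subspace of polynomials of degree at most $D$ in the edge indicator variables; let $\|\cdot\|$ be the norm of $L^2(\mathbb{Q})$. If $d\eta^2 < 1$, then for every sequence of natural numbers $D = D(n)$ with $D(n) = o(n/\log n)$ we have $\|L^{\le D(n)}\| = O(1)$ as $n \to \infty$. -/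

import Mathlib

open MeasureTheory Filter Asymptotics
open scoped ENNReal

namespace SBM

noncomputable section

/-- The potential edges of a graph on `n` vertices: the pairs `(u, v)` with `u < v`. -/
abbrev Pair (n : ℕ) : Type := {e : Fin n × Fin n // e.1 < e.2}

instance (n : ℕ) : DiscreteMeasurableSpace (SimpleGraph (Fin n)) where
  forall_measurableSet s :=
    ⟨SimpleGraph.Adj '' s, MeasurableSet.of_discrete,
      Set.preimage_image_eq s SimpleGraph.adj_injective⟩

open Classical in
/-- The probability of the graph `G` when each edge `(u, v)`, `u < v`, occurs independently with
probability `w (u, v)`. -/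
def edgeProduct {n : ℕ} (w : Pair n → unitInterval) (G : SimpleGraph (Fin n)) : ℝ :=
  ∏ e : Pair n, if G.Adj e.1.1 e.1.2 then (w e : ℝ) else 1 - (w e : ℝ)

/-- The law of the random graph on `n` vertices in which each edge `(u, v)`, `u < v`, occurs
independently with probability `w (u, v)`. -/
def independentEdges {n : ℕ} (w : Pair n → unitInterval) : Measure (SimpleGraph (Fin n)) :=
  ∑ G : SimpleGraph (Fin n), ENNReal.ofReal (edgeProduct w G) • Measure.dirac G

instance {n : ℕ} (w : Pair n → unitInterval) : IsFiniteMeasure (independentEdges w) := by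
  refine ⟨?_⟩
  simp [independentEdges, Measure.finsetSum_apply, ENNReal.sum_lt_top]

/-- A real number regarded as a probability. Numbers in `[0, 1]` are unchanged, the others are
truncated to `[0, 1]`. -/
def toProb (x : ℝ) : unitInterval := Set.projIcc 0 1 zero_le_one x

/-- The null distribution: each edge occurs independently with probability `d / n`
(which lies in `[0, 1]` as soon as `d ≤ n`). -/
def null (d : ℝ) (n : ℕ) : Measure (SimpleGraph (Fin n)) :=
  independentEdges fun _ => toProb (d / n)

instance (d : ℝ) (n : ℕ) : IsFiniteMeasure (null d n) :=
  inferInstanceAs (IsFiniteMeasure (independentEdges _))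

/-- The planted distribution conditioned on the community labels `σ`: edges occur independently,
with probability `(1 + (k - 1) η) d / n` inside a community and `(1 - η) d / n` across
communities (for the parameters considered, these lie in `[0, 1]` for all large `n`). -/
def plantedGiven (k : ℕ) (d η : ℝ) (n : ℕ) (σ : Fin n → Fin k) :
    Measure (SimpleGraph (Fin n)) :=
  independentEdges fun e =>
    if σ e.1.1 = σ e.1.2 then toProb ((1 + ((k : ℝ) - 1) * η) * d / n)
    else toProb ((1 - η) * d / n)

/-- The planted distribution: the labels of the `n` vertices are independent and uniform on the
`k` communities, so that the law is the average over all `k ^ n` labellings. -/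
def planted (k : ℕ) (d η : ℝ) (n : ℕ) : Measure (SimpleGraph (Fin n)) :=
  ((k : ℝ≥0∞) ^ n)⁻¹ • ∑ σ : Fin n → Fin k, plantedGiven k d η n σ

open Classical in
/-- The indicator variables of the edges of `G`. -/
def edgeIndicator {n : ℕ} (G : SimpleGraph (Fin n)) (e : Pair n) : ℝ :=
  if G.Adj e.1.1 e.1.2 then 1 else 0

/-- A polynomial in the edge indicator variables, as a function of the graph. -/
def polyEval (n : ℕ) : MvPolynomial (Pair n) ℝ →ₗ[ℝ] (SimpleGraph (Fin n) → ℝ) where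
  toFun p G := MvPolynomial.eval (edgeIndicator G) p
  map_add' p q := by ext G; simp
  map_smul' c p := by ext G; simp

/-- A real function of the graph, as an element of `L²(μ)`. -/
def toL2 {n : ℕ} (μ : Measure (SimpleGraph (Fin n))) [IsFiniteMeasure μ] :
    (SimpleGraph (Fin n) → ℝ) →ₗ[ℝ] Lp ℝ 2 μ where
  toFun f := MemLp.toLp f MemLp.of_discrete
  map_add' _ _ := rfl
  map_smul' _ _ := rfl

/-- The subspace of `L²(μ)` of the polynomials of degree at most `D` in the edge indicators. -/
def lowDegree {n : ℕ} (μ : Measure (SimpleGraph (Fin n))) [IsFiniteMeasure μ] (D : ℕ) :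
    Submodule ℝ (Lp ℝ 2 μ) :=
  ((MvPolynomial.restrictTotalDegree (Pair n) ℝ D).map (polyEval n)).map (toL2 μ)

instance {n : ℕ} (μ : Measure (SimpleGraph (Fin n))) [IsFiniteMeasure μ] (D : ℕ) :
    FiniteDimensional ℝ (lowDegree μ D) :=
  inferInstanceAs (FiniteDimensional ℝ
    (((MvPolynomial.restrictTotalDegree (Pair n) ℝ D).map (polyEval n)).map (toL2 μ) :
      Submodule ℝ (Lp ℝ 2 μ)))

/-- The likelihood ratio `L = dP/dQ` of the planted distribution `P` with respect to the null
distribution `Q`, as an element of `L²(Q)`. -/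
def likelihoodRatio (k : ℕ) (d η : ℝ) (n : ℕ) : Lp ℝ 2 (null d n) :=
  toL2 (null d n) fun G => ((planted k d η n).rnDeriv (null d n) G).toReal

/-- The low-degree likelihood ratio `L^{≤ D}`: the orthogonal projection in `L²(Q)` of the
likelihood ratio to the subspace of polynomials of degree at most `D`. -/
def lowDegreeLikelihoodRatio (k : ℕ) (d η : ℝ) (n D : ℕ) : Lp ℝ 2 (null d n) :=
  (lowDegree (null d n) D).starProjection (likelihoodRatio k d η n)

end

end SBM

namespace SBM

/-! In the orthonormal basis of edge characters, the squared norm of the projection is at most the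
sum of the squared planted means of the characters with at most `D` edges. Writing each square as an
average over two independent labellings bounds this by the mean of the exponential series truncated
at degree `D`, evaluated at `lam` times the overlap of the two labellings (`sum_prod_sq_le_sum_pow`,
`norm_lowDegreeLikelihoodRatio_sq_le`).

Up to a diagonal term of order `n`, the overlap is half the squared length of a sum of `n`
independent centred vectors, one for each pair of labels, with covariance at most the identity
(`sum_wordSum_sq`, `sum_labelFeature_sq_le`). Since `lam * n` tends to `d * η ^ 2 < 1`, the
exponential moment behaves like that of a Gaussian below its critical value, as long as the sum
stays in a small multiple of `n` (`exists_sum_exp_sq_wordSum_le`).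

Outside that region the full exponential may be too large, but the region's complement has
exponentially small probability (`exists_card_large_wordSum_le`). The truncated series there is at
most `(K * n) ^ D`, which is `exp (o(n))` because `D = o(n / log n)` (`eventually_pow_le_exp`). -/

lemma exp_le_quadratic {δ t : ℝ} (h1 : |t| ≤ 1) (hδ : |t| ≤ δ) :
    Real.exp t ≤ 1 + t + (1 + δ) / 2 * t ^ 2 := by
  have h := (abs_le.mp (Real.exp_bound h1 (n := 3) (by norm_num))).2
  simp only [Finset.sum_range_succ, Finset.sum_range_zero, Nat.factorial] at h
  have h3 : |t| ^ 3 ≤ δ * t ^ 2 := by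
    rw [pow_succ, sq_abs, mul_comm]
    exact mul_le_mul_of_nonneg_right hδ (sq_nonneg t)
  have h0 : 0 ≤ δ * t ^ 2 := le_trans (by positivity) h3
  norm_num at h
  nlinarith

/-! ### Exponential moments and large deviations of sums of independent vectors -/

section Core

variable {α ι : Type*} [Fintype α] [Fintype ι]

/-- A local sub-Gaussian bound: the moment generating function of a centred vector whose covariance
is at most the identity is close to that of a standard Gaussian vector near the origin. -/
lemma exists_sum_exp_le (Y : α → ι → ℝ) (hmean : ∀ i, ∑ a, Y a i = 0)
    (hcov : ∀ h : ι → ℝ, ∑ a, (∑ i, h i * Y a i) ^ 2 ≤ Fintype.card α * ∑ i, h i ^ 2)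
    {δ : ℝ} (hδ : 0 < δ) :
    ∃ ρ > 0, ∀ h : ι → ℝ, (∀ i, |h i| ≤ ρ) →
      ∑ a, Real.exp (∑ i, h i * Y a i) ≤
        Fintype.card α * Real.exp ((1 + δ) / 2 * ∑ i, h i ^ 2) := by
  set B : ℝ := (∑ a, ∑ i, |Y a i|) + 1 with hB
  have hBpos : 0 < B := by positivity
  have hm : 0 < min 1 δ := lt_min one_pos hδ
  refine ⟨min 1 δ / B, by positivity, fun h hh => ?_⟩
  have key : ∀ a, |∑ i, h i * Y a i| ≤ min 1 δ := by
    intro a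
    calc |∑ i, h i * Y a i| ≤ ∑ i, |h i * Y a i| := Finset.abs_sum_le_sum_abs _ _
      _ ≤ ∑ i, min 1 δ / B * |Y a i| := by
          refine Finset.sum_le_sum fun i _ => ?_
          rw [abs_mul]
          exact mul_le_mul_of_nonneg_right (hh i) (abs_nonneg _)
      _ = min 1 δ / B * ∑ i, |Y a i| := by rw [Finset.mul_sum]
      _ ≤ min 1 δ / B * B := by
          refine mul_le_mul_of_nonneg_left ?_ (by positivity)
          have := Finset.single_le_sum (f := fun a => ∑ i, |Y a i|)
            (fun a _ => by positivity) (Finset.mem_univ a)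
          linarith
      _ = min 1 δ := by field_simp
  calc ∑ a, Real.exp (∑ i, h i * Y a i)
      ≤ ∑ a, (1 + ∑ i, h i * Y a i + (1 + δ) / 2 * (∑ i, h i * Y a i) ^ 2) :=
        Finset.sum_le_sum fun a _ => exp_le_quadratic ((key a).trans (min_le_left _ _))
          ((key a).trans (min_le_right _ _))
    _ = Fintype.card α + (1 + δ) / 2 * ∑ a, (∑ i, h i * Y a i) ^ 2 := by
        have h0 : ∑ a, ∑ i, h i * Y a i = 0 := by
          rw [Finset.sum_comm]
          simp [← Finset.mul_sum, hmean]
        rw [Finset.sum_add_distrib, Finset.sum_add_distrib, h0, ← Finset.mul_sum]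
        simp
    _ ≤ Fintype.card α + (1 + δ) / 2 * (Fintype.card α * ∑ i, h i ^ 2) := by
        gcongr
        exact hcov h
    _ = Fintype.card α * ((1 + δ) / 2 * ∑ i, h i ^ 2 + 1) := by ring
    _ ≤ _ := by
        gcongr
        exact Real.add_one_le_exp _

/-- The sum of the feature vectors of a word. -/
def wordSum (Y : α → ι → ℝ) {n : ℕ} (τ : Fin n → α) (i : ι) : ℝ := ∑ u, Y (τ u) i

lemma sum_exp_wordSum (Y : α → ι → ℝ) (n : ℕ) (h : ι → ℝ) :
    ∑ τ : Fin n → α, Real.exp (∑ i, h i * wordSum Y τ i) =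
      (∑ a, Real.exp (∑ i, h i * Y a i)) ^ n := by
  rw [Fintype.sum_pow]
  refine Finset.sum_congr rfl fun τ _ => ?_
  rw [← Real.exp_sum]
  congr 1
  simp only [wordSum, Finset.mul_sum]
  rw [Finset.sum_comm]

/-- A discrete form of the Hubbard–Stratonovich transform. -/
lemma exp_sq_le_sum_box [DecidableEq ι] (v : ι → ℝ) (R : ℤ) (hv : ∀ i, |v i| + 1 / 2 ≤ R) :
    Real.exp (1 / 2 * ∑ i, v i ^ 2) ≤ Real.exp (1 / 8 * Fintype.card ι) *
      ∑ j ∈ Fintype.piFinset (fun _ : ι => Finset.Icc (-R) R),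
        Real.exp ((∑ i, (j i : ℝ) * v i) - 1 / 2 * ∑ i, (j i : ℝ) ^ 2) := by
  -- One term of the sum suffices, the nearest integer point `j`: completing the square leaves `|v -
  -- j|² / 2`, at most `1 / 8` per coordinate.
  have hmem : (fun i => round (v i)) ∈ Fintype.piFinset (fun _ : ι => Finset.Icc (-R) R) := by
    rw [Fintype.mem_piFinset]
    intro i
    have h1 := abs_le.mp (abs_sub_round (v i))
    have h2 := hv i
    have h3 := abs_le.mp (show |v i| ≤ R - 1 / 2 by linarith)
    rw [Finset.mem_Icc]
    constructor
    · have : ((-R : ℤ) : ℝ) ≤ round (v i) := by push_cast; linarith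
      exact_mod_cast this
    · have : (round (v i) : ℝ) ≤ R := by linarith
      exact_mod_cast this
  have h1 := Finset.single_le_sum (f := fun j : ι → ℤ =>
    Real.exp ((∑ i, (j i : ℝ) * v i) - 1 / 2 * ∑ i, (j i : ℝ) ^ 2))
    (fun _ _ => (Real.exp_pos _).le) hmem
  refine le_trans ?_ (mul_le_mul_of_nonneg_left h1 (Real.exp_pos _).le)
  rw [← Real.exp_add, Real.exp_le_exp]
  have h2 : ∑ i, (v i - round (v i)) ^ 2 ≤ ∑ _i : ι, (1 / 4 : ℝ) := by
    refine Finset.sum_le_sum fun i _ => ?_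
    have := abs_sub_round (v i)
    rw [← sq_abs]
    nlinarith [abs_nonneg (v i - round (v i))]
  have h3 : ∑ i, (v i - round (v i)) ^ 2 =
      ∑ i, v i ^ 2 - 2 * ∑ i, (round (v i) : ℝ) * v i + ∑ i, (round (v i) : ℝ) ^ 2 := by
    rw [Finset.mul_sum, ← Finset.sum_sub_distrib, ← Finset.sum_add_distrib]
    exact Finset.sum_congr rfl fun i _ => by ring
  rw [h3] at h2
  simp only [Finset.sum_const, Finset.card_univ, nsmul_eq_mul] at h2
  linarith

lemma summable_exp_neg_mul_int_sq {c : ℝ} (hc : 0 < c) :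
    Summable fun l : ℤ => Real.exp (-c * (l : ℝ) ^ 2) := by
  have h : Summable fun n : ℕ => Real.exp (-c * (n : ℝ) ^ 2) := by
    refine Summable.of_nonneg_of_le (fun _ => (Real.exp_pos _).le) (fun n => ?_)
      (Real.summable_exp_nat_mul_iff.mpr (neg_neg_of_pos hc))
    rw [Real.exp_le_exp]
    have : (n : ℝ) ≤ (n : ℝ) ^ 2 := by exact_mod_cast Nat.le_self_pow two_ne_zero n
    nlinarith
  exact Summable.of_nat_of_neg (by simpa using h) (by simpa using h)

/-- The discrete Hubbard–Stratonovich bound linearizes the square at scale `s = √(θ / n)`. Each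
linear term then factors over the letters, and `hY` leaves a weight `exp (-c * j ^ 2)` per
coordinate with `c > 0`, summable over all integers uniformly in `n`. -/
lemma exists_sum_exp_sq_wordSum_le (Y : α → ι → ℝ) {θ δ ρ : ℝ} (hθ : 0 < θ) (hθ1 : θ ≤ 1)
    (hρ : 0 < ρ) (hδ : (1 + δ) * θ < 1)
    (hY : ∀ h : ι → ℝ, (∀ i, |h i| ≤ ρ) → ∑ a, Real.exp (∑ i, h i * Y a i) ≤
        Fintype.card α * Real.exp ((1 + δ) / 2 * ∑ i, h i ^ 2)) :
    ∃ C : ℝ, ∀ᶠ n : ℕ in atTop,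
      ∑ τ : Fin n → α with ∀ i, |wordSum Y τ i| ≤ ρ / 2 * n,
        Real.exp (θ / (2 * n) * ∑ i, wordSum Y τ i ^ 2) ≤ C * (Fintype.card α : ℝ) ^ n := by
  classical
  set c : ℝ := (1 - (1 + δ) * θ) / 2 with hc
  have hcpos : 0 < c := by rw [hc]; linarith
  set S : ℝ := ∑' l : ℤ, Real.exp (-c * (l : ℝ) ^ 2) with hS
  refine ⟨Real.exp (1 / 8 * Fintype.card ι) * S ^ Fintype.card ι, ?_⟩
  have hlim : Tendsto (fun n : ℕ => ρ / 2 * √(n : ℝ)) atTop atTop :=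
    (Real.tendsto_sqrt_atTop.comp tendsto_natCast_atTop_atTop).const_mul_atTop (by positivity)
  filter_upwards [hlim.eventually_ge_atTop (3 / 2), eventually_gt_atTop 0] with n hn hn0
  have hn0' : (0 : ℝ) < n := by exact_mod_cast hn0
  set s : ℝ := √(θ / n) with hs
  have hs0 : 0 ≤ s := Real.sqrt_nonneg _
  have hs2 : s ^ 2 = θ / n := Real.sq_sqrt (by positivity)
  have hsn : s * √(n : ℝ) ≤ 1 := by
    rw [hs, ← Real.sqrt_mul (by positivity), div_mul_cancel₀ _ hn0'.ne']
    exact Real.sqrt_le_one.mpr hθ1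
  set R : ℤ := ⌊ρ * √(n : ℝ)⌋ with hR
  have hR1 : (R : ℝ) ≤ ρ * √(n : ℝ) := Int.floor_le _
  have hR2 : ρ / 2 * √(n : ℝ) + 1 / 2 ≤ R := by
    have := Int.sub_one_lt_floor (ρ * √(n : ℝ))
    linarith
  set J := Fintype.piFinset (fun _ : ι => Finset.Icc (-R) R) with hJ
  have hterm : ∀ j ∈ J, ∑ τ : Fin n → α,
      Real.exp ((∑ i, (j i : ℝ) * (s * wordSum Y τ i)) - 1 / 2 * ∑ i, (j i : ℝ) ^ 2) ≤
      (Fintype.card α : ℝ) ^ n * ∏ i, Real.exp (-c * (j i : ℝ) ^ 2) := by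
    intro j hj
    have hjR : ∀ i, |(s * j i : ℝ)| ≤ ρ := by
      intro i
      have h1 := Finset.mem_Icc.mp (Fintype.mem_piFinset.mp hj i)
      have h2 : |(j i : ℝ)| ≤ R := by
        rw [abs_le]; exact ⟨by exact_mod_cast h1.1, by exact_mod_cast h1.2⟩
      rw [abs_mul, abs_of_nonneg hs0]
      calc s * |(j i : ℝ)| ≤ s * (ρ * √(n : ℝ)) := by gcongr; exact h2.trans hR1
        _ = ρ * (s * √(n : ℝ)) := by ring
        _ ≤ ρ * 1 := by gcongr
        _ = ρ := mul_one _
    have h1 := hY (fun i => s * j i) hjR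
    have h2 := pow_le_pow_left₀ (by positivity) h1 n
    rw [← sum_exp_wordSum, mul_pow, ← Real.exp_nat_mul] at h2
    calc _ = (∑ τ : Fin n → α, Real.exp (∑ i, s * (j i : ℝ) * wordSum Y τ i)) *
          Real.exp (-(1 / 2 * ∑ i, (j i : ℝ) ^ 2)) := by
            rw [Finset.sum_mul]
            refine Finset.sum_congr rfl fun τ _ => ?_
            rw [sub_eq_add_neg, Real.exp_add]
            congr 2
            exact Finset.sum_congr rfl fun i _ => by ring
      _ ≤ _ := mul_le_mul_of_nonneg_right h2 (Real.exp_pos _).le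
      _ = _ := by
            rw [mul_assoc, ← Real.exp_add, ← Real.exp_sum]
            congr 2
            simp only [mul_pow, hs2, ← Finset.mul_sum]
            rw [hc]
            field_simp
            ring
  calc ∑ τ : Fin n → α with ∀ i, |wordSum Y τ i| ≤ ρ / 2 * n,
        Real.exp (θ / (2 * n) * ∑ i, wordSum Y τ i ^ 2)
      ≤ ∑ τ : Fin n → α with ∀ i, |wordSum Y τ i| ≤ ρ / 2 * n,
          Real.exp (1 / 8 * Fintype.card ι) * ∑ j ∈ J,
          Real.exp ((∑ i, (j i : ℝ) * (s * wordSum Y τ i)) - 1 / 2 * ∑ i, (j i : ℝ) ^ 2) := by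
        refine Finset.sum_le_sum fun τ hτ => ?_
        have hτ' := (Finset.mem_filter.mp hτ).2
        refine le_trans (le_of_eq ?_) (exp_sq_le_sum_box (fun i => s * wordSum Y τ i) R fun i => ?_)
        · simp only [mul_pow, hs2, ← Finset.mul_sum]
          congr 1
          field_simp
        · rw [abs_mul, abs_of_nonneg hs0]
          have : s * |wordSum Y τ i| ≤ ρ / 2 * √(n : ℝ) :=
            calc s * |wordSum Y τ i| ≤ s * (ρ / 2 * n) := by gcongr; exact hτ' i
              _ = ρ / 2 * √(n : ℝ) * (s * √(n : ℝ)) := by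
                  nth_rewrite 1 [← Real.mul_self_sqrt hn0'.le]; ring
              _ ≤ ρ / 2 * √(n : ℝ) * 1 := by gcongr
              _ = _ := mul_one _
          linarith
    -- Once the square is linearized, the restriction on the words can be dropped, so that the sum
    -- factors over letters.
    _ ≤ ∑ τ : Fin n → α, Real.exp (1 / 8 * Fintype.card ι) * ∑ j ∈ J,
          Real.exp ((∑ i, (j i : ℝ) * (s * wordSum Y τ i)) - 1 / 2 * ∑ i, (j i : ℝ) ^ 2) :=
        Finset.sum_le_sum_of_subset_of_nonneg (Finset.subset_univ _)
          fun _ _ _ => by positivity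
    _ = Real.exp (1 / 8 * Fintype.card ι) * ∑ j ∈ J, ∑ τ : Fin n → α,
          Real.exp ((∑ i, (j i : ℝ) * (s * wordSum Y τ i)) - 1 / 2 * ∑ i, (j i : ℝ) ^ 2) := by
        rw [← Finset.mul_sum, Finset.sum_comm]
    _ ≤ Real.exp (1 / 8 * Fintype.card ι) * ∑ j ∈ J,
          (Fintype.card α : ℝ) ^ n * ∏ i, Real.exp (-c * (j i : ℝ) ^ 2) := by
        gcongr with j hj
        exact hterm j hj
    _ = Real.exp (1 / 8 * Fintype.card ι) * (Fintype.card α : ℝ) ^ n *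
          ∏ _i : ι, ∑ l ∈ Finset.Icc (-R) R, Real.exp (-c * (l : ℝ) ^ 2) := by
        rw [← Finset.mul_sum, Finset.prod_univ_sum, mul_assoc]
    _ ≤ Real.exp (1 / 8 * Fintype.card ι) * (Fintype.card α : ℝ) ^ n * ∏ _i : ι, S := by
        gcongr
        exact (summable_exp_neg_mul_int_sq hcpos).sum_le_tsum _ fun _ _ => (Real.exp_pos _).le
    _ = _ := by
        rw [Finset.prod_const, Finset.card_univ]; ring

/-- Chernoff's bound with tilt `±ε / 2` in each coordinate, and a union bound over coordinates and
signs. As `δ ≤ 1`, the moment generating function costs at most `ε ^ 2 / 4` per letter against a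
gain of `ε ^ 2 / 2`. -/
lemma exists_card_large_wordSum_le (Y : α → ι → ℝ) {δ ρ ε : ℝ} (hδ : δ ≤ 1)
    (hε : 0 < ε) (hερ : ε ≤ ρ)
    (hY : ∀ h : ι → ℝ, (∀ i, |h i| ≤ ρ) → ∑ a, Real.exp (∑ i, h i * Y a i) ≤
        Fintype.card α * Real.exp ((1 + δ) / 2 * ∑ i, h i ^ 2)) (n : ℕ) :
    ((Finset.univ.filter fun τ : Fin n → α => ¬ ∀ i, |wordSum Y τ i| ≤ ε * n).card : ℝ) ≤
      2 * Fintype.card ι * Real.exp (-(ε ^ 2 / 4) * n) * (Fintype.card α : ℝ) ^ n := by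
  classical
  have hmgf : ∀ (i : ι) (t : ℝ), |t| = ε / 2 →
      ∑ τ : Fin n → α, Real.exp (t * wordSum Y τ i - ε ^ 2 / 2 * n) ≤
        Real.exp (-(ε ^ 2 / 4) * n) * (Fintype.card α : ℝ) ^ n := by
    intro i t ht
    have h1 := hY (Pi.single i t) (fun i' => by
      by_cases h : i' = i
      · subst h; simp only [Pi.single_eq_same, ht]; linarith
      · rw [Pi.single_eq_of_ne h, abs_zero]; linarith)
    have h2 := pow_le_pow_left₀ (by positivity) h1 n
    rw [← sum_exp_wordSum, mul_pow, ← Real.exp_nat_mul] at h2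
    have e1 : ∀ f : ι → ℝ, ∑ i', (Pi.single i t : ι → ℝ) i' * f i' = t * f i := by
      intro f
      rw [Finset.sum_eq_single i] <;> simp +contextual [Pi.single_eq_of_ne]
    have e2 : ∑ i', (Pi.single i t : ι → ℝ) i' ^ 2 = t ^ 2 := by
      simp only [pow_two, e1, Pi.single_eq_same]
    simp only [e1] at h2
    rw [e2] at h2
    have ht2 : t ^ 2 = ε ^ 2 / 4 := by rw [← sq_abs, ht]; ring
    calc ∑ τ : Fin n → α, Real.exp (t * wordSum Y τ i - ε ^ 2 / 2 * n)
        = (∑ τ : Fin n → α, Real.exp (t * wordSum Y τ i)) * Real.exp (-(ε ^ 2 / 2 * n)) := by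
          rw [Finset.sum_mul]
          exact Finset.sum_congr rfl fun τ _ => by rw [← Real.exp_add, sub_eq_add_neg]
      _ ≤ _ := mul_le_mul_of_nonneg_right h2 (Real.exp_pos _).le
      _ ≤ _ := by
          rw [mul_assoc, ← Real.exp_add, mul_comm, ht2]
          gcongr
          have : 0 ≤ (n : ℝ) * ε ^ 2 := by positivity
          nlinarith
  calc ((Finset.univ.filter fun τ : Fin n → α => ¬ ∀ i, |wordSum Y τ i| ≤ ε * n).card : ℝ)
      = ∑ τ : Fin n → α with ¬ ∀ i, |wordSum Y τ i| ≤ ε * n, (1 : ℝ) := by simp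
    _ ≤ ∑ τ : Fin n → α with ¬ ∀ i, |wordSum Y τ i| ≤ ε * n,
          ∑ i, (Real.exp (ε / 2 * wordSum Y τ i - ε ^ 2 / 2 * n) +
            Real.exp (-(ε / 2) * wordSum Y τ i - ε ^ 2 / 2 * n)) := by
        refine Finset.sum_le_sum fun τ hτ => ?_
        obtain ⟨i, hi⟩ := not_forall.mp (Finset.mem_filter.mp hτ).2
        refine le_trans ?_ (Finset.single_le_sum (f := fun i =>
          (Real.exp (ε / 2 * wordSum Y τ i - ε ^ 2 / 2 * n) +
            Real.exp (-(ε / 2) * wordSum Y τ i - ε ^ 2 / 2 * n))) (fun _ _ => by positivity)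
          (Finset.mem_univ i))
        rcases lt_abs.mp (not_le.mp hi) with h | h
        · have : 1 ≤ Real.exp (ε / 2 * wordSum Y τ i - ε ^ 2 / 2 * n) :=
            Real.one_le_exp (by nlinarith)
          linarith [Real.exp_pos (-(ε / 2) * wordSum Y τ i - ε ^ 2 / 2 * n)]
        · have : 1 ≤ Real.exp (-(ε / 2) * wordSum Y τ i - ε ^ 2 / 2 * n) :=
            Real.one_le_exp (by nlinarith)
          linarith [Real.exp_pos (ε / 2 * wordSum Y τ i - ε ^ 2 / 2 * n)]
    _ ≤ ∑ τ : Fin n → α, ∑ i, (Real.exp (ε / 2 * wordSum Y τ i - ε ^ 2 / 2 * n) +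
            Real.exp (-(ε / 2) * wordSum Y τ i - ε ^ 2 / 2 * n)) :=
        Finset.sum_le_sum_of_subset_of_nonneg (Finset.subset_univ _)
          fun _ _ _ => by positivity
    _ = ∑ i, (∑ τ : Fin n → α, Real.exp (ε / 2 * wordSum Y τ i - ε ^ 2 / 2 * n) +
            ∑ τ : Fin n → α, Real.exp (-(ε / 2) * wordSum Y τ i - ε ^ 2 / 2 * n)) := by
        rw [Finset.sum_comm]
        exact Finset.sum_congr rfl fun i _ => Finset.sum_add_distrib
    _ ≤ ∑ _i : ι, (Real.exp (-(ε ^ 2 / 4) * n) * (Fintype.card α : ℝ) ^ n +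
            Real.exp (-(ε ^ 2 / 4) * n) * (Fintype.card α : ℝ) ^ n) :=
        Finset.sum_le_sum fun i _ => add_le_add
          (hmgf i _ (abs_of_pos (by positivity)))
          (hmgf i _ (by rw [abs_neg, abs_of_pos (by positivity)]))
    _ = _ := by
        simp only [Finset.sum_const, Finset.card_univ, nsmul_eq_mul]; ring

end Core

/-! ### From squared character means to moments of the overlap -/

section Moments

variable {Ω E : Type*} [Fintype Ω] [Fintype E] [DecidableEq E]

/-- By the multinomial theorem and the product structure over the two replicas, the right side is a
combination of squares with nonnegative coefficients. The squarefree exponents have coefficient `m!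
/ m! = 1` and give the left side; the others are discarded. -/
lemma sum_prod_sq_le_sum_pow (z : Ω → E → ℝ) (m : ℕ) :
    ∑ S ∈ Finset.powersetCard m (Finset.univ : Finset E), (∑ σ, ∏ e ∈ S, z σ e) ^ 2 ≤
      ∑ σ, ∑ σ', (∑ e, z σ e * z σ' e) ^ m / (m.factorial : ℝ) := by
  have hR : ∑ σ, ∑ σ', (∑ e, z σ e * z σ' e) ^ m / (m.factorial : ℝ) =
      ∑ κ ∈ Finset.piAntidiag (Finset.univ : Finset E) m,
        (Nat.multinomial Finset.univ κ : ℝ) / m.factorial * (∑ σ, ∏ e, z σ e ^ κ e) ^ 2 := by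
    simp only [Finset.sum_pow_eq_sum_piAntidiag, Finset.sum_div]
    simp only [Finset.sum_comm (t := Finset.piAntidiag (Finset.univ : Finset E) m)]
    refine Finset.sum_congr rfl fun κ _ => ?_
    rw [pow_two, Finset.sum_mul_sum, Finset.mul_sum]
    refine Finset.sum_congr rfl fun σ _ => ?_
    rw [Finset.mul_sum]
    refine Finset.sum_congr rfl fun σ' _ => ?_
    simp only [mul_pow, Finset.prod_mul_distrib]
    ring
  rw [hR]
  set ind : Finset E → E → ℕ := fun S e => if e ∈ S then 1 else 0 with hind
  have hinj : Function.Injective ind := by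
    intro S T h
    ext e
    have := congrFun h e
    simp only [hind] at this
    by_cases h1 : e ∈ S <;> by_cases h2 : e ∈ T <;> simp_all
  have hL : ∑ S ∈ Finset.powersetCard m (Finset.univ : Finset E), (∑ σ, ∏ e ∈ S, z σ e) ^ 2 =
      ∑ κ ∈ (Finset.powersetCard m (Finset.univ : Finset E)).image ind,
        (Nat.multinomial Finset.univ κ : ℝ) / m.factorial * (∑ σ, ∏ e, z σ e ^ κ e) ^ 2 := by
    rw [Finset.sum_image hinj.injOn]
    refine Finset.sum_congr rfl fun S hS => ?_
    have hcard := (Finset.mem_powersetCard.mp hS).2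
    have h1 : Nat.multinomial Finset.univ (ind S) = m.factorial := by
      have h2 : ∏ e, (ind S e).factorial = 1 :=
        Finset.prod_eq_one fun e _ => by simp only [hind]; split_ifs <;> rfl
      have h3 : ∑ e, ind S e = m := by simp [hind, hcard]
      rw [Nat.multinomial, h2, h3, Nat.div_one]
    rw [h1, div_self (by positivity), one_mul]
    congr 1
    refine Finset.sum_congr rfl fun σ _ => ?_
    simp only [hind, pow_ite, pow_one, pow_zero, Finset.prod_ite_mem, Finset.univ_inter]
  rw [hL]
  refine Finset.sum_le_sum_of_subset_of_nonneg ?_ fun _ _ _ => by positivity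
  intro κ hκ
  obtain ⟨S, hS, rfl⟩ := Finset.mem_image.mp hκ
  rw [Finset.mem_piAntidiag]
  exact ⟨by simp [hind, (Finset.mem_powersetCard.mp hS).2], fun _ _ => Finset.mem_univ _⟩

lemma sum_card_le_prod_sq_le (z : Ω → E → ℝ) (D : ℕ) :
    ∑ S : Finset E with S.card ≤ D, (∑ σ, ∏ e ∈ S, z σ e) ^ 2 ≤
      ∑ σ, ∑ σ', ∑ m ∈ Finset.range (D + 1),
        (∑ e, z σ e * z σ' e) ^ m / (m.factorial : ℝ) := by
  simp only [Finset.sum_comm (t := Finset.range (D + 1))]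
  rw [← Finset.sum_fiberwise_of_maps_to (t := Finset.range (D + 1)) (g := Finset.card)
    (fun S hS => Finset.mem_range.mpr (Nat.lt_succ_of_le (Finset.mem_filter.mp hS).2))]
  refine Finset.sum_le_sum fun m hm => le_trans (le_of_eq ?_) (sum_prod_sq_le_sum_pow z m)
  refine Finset.sum_congr ?_ fun _ _ => rfl
  ext S
  have := Finset.mem_range.mp hm
  simp only [Finset.mem_filter, Finset.mem_univ, true_and, Finset.mem_powersetCard,
    Finset.subset_univ]
  omega

end Moments

/-! ### A Bessel-type bound for projections -/

section Projection

variable {E ι : Type*} [NormedAddCommGroup E] [InnerProductSpace ℝ E]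

/-- Writing the projection as `∑ c i • v i`, its squared norm is both `∑ c i ^ 2` and, by
orthogonality of the residual, `∑ c i * ⟪v i, x⟫`. Cauchy–Schwarz and cancellation finish, so `K`
need only lie inside the span. -/
lemma norm_starProjection_sq_le {K : Submodule ℝ E} [K.HasOrthogonalProjection] {v : ι → E}
    (hv : Orthonormal ℝ v) (s : Finset ι) (hK : K ≤ Submodule.span ℝ (v '' s)) (x : E) :
    ‖K.starProjection x‖ ^ 2 ≤ ∑ i ∈ s, inner ℝ (v i) x ^ 2 := by
  obtain ⟨c, hc⟩ := (Submodule.mem_span_image_finset_iff_exists_fun' ℝ).mp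
    (hK (K.starProjection_apply_mem x))
  have h1 : ‖K.starProjection x‖ ^ 2 = ∑ i ∈ s, c i ^ 2 := by
    rw [← real_inner_self_eq_norm_sq, ← hc, hv.inner_sum]
    simp [pow_two]
  have h2 : ‖K.starProjection x‖ ^ 2 = ∑ i ∈ s, c i * inner ℝ (v i) x := by
    have h3 := K.starProjection_inner_eq_zero x _ (K.starProjection_apply_mem x)
    rw [inner_sub_left, sub_eq_zero, real_inner_self_eq_norm_sq] at h3
    rw [← h3]
    nth_rewrite 1 [← hc]
    rw [inner_sum]
    refine Finset.sum_congr rfl fun i _ => ?_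
    rw [inner_smul_right, real_inner_comm]
  have h4 := Finset.sum_mul_sq_le_sq_mul_sq s c fun i => inner ℝ (v i) x
  rw [← h2, ← h1] at h4
  rcases (sq_nonneg ‖K.starProjection x‖).eq_or_lt with h0 | h0
  · rw [← h0]
    exact Finset.sum_nonneg fun _ _ => sq_nonneg _
  · rw [pow_two (‖K.starProjection x‖ ^ 2)] at h4
    exact le_of_mul_le_mul_left h4 h0

end Projection

/-! ### Fourier analysis on random graphs -/

section Fourier

variable {n : ℕ}

open Classical in
lemma sum_graph_prod (a b : Pair n → ℝ) :
    ∑ G : SimpleGraph (Fin n), ∏ e : Pair n, (if G.Adj e.1.1 e.1.2 then a e else b e) =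
      ∏ e, (a e + b e) := by
  rw [Finset.prod_add]
  refine Finset.sum_bij' (fun G _ => Finset.univ.filter fun e : Pair n => G.Adj e.1.1 e.1.2)
    (fun s _ => SimpleGraph.fromRel fun u v => ∃ h : u < v, (⟨(u, v), h⟩ : Pair n) ∈ s)
    (fun _ _ => by simp) (fun _ _ => Finset.mem_univ _) ?_ ?_ ?_
  · intro G _
    ext u v
    simp only [SimpleGraph.fromRel_adj, Finset.mem_filter, Finset.mem_univ, true_and]
    constructor
    · rintro ⟨_, ⟨_, h⟩ | ⟨_, h⟩⟩
      · exact h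
      · exact h.symm
    · intro h
      refine ⟨h.ne, ?_⟩
      rcases lt_or_gt_of_ne h.ne with h1 | h1
      · exact Or.inl ⟨h1, h⟩
      · exact Or.inr ⟨h1, h.symm⟩
  · intro s _
    ext ⟨⟨u, v⟩, h⟩
    simp only [SimpleGraph.fromRel_adj, Finset.mem_filter, Finset.mem_univ, true_and]
    simp only at h
    constructor
    · rintro ⟨_, ⟨_, h'⟩ | ⟨h', _⟩⟩
      · exact h'
      · exact absurd h h'.asymm
    · exact fun h' => ⟨h.ne, Or.inl ⟨h, h'⟩⟩
  · intro G _
    rw [Finset.prod_ite, ← Finset.filter_not]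

lemma edgeProduct_nonneg (w : Pair n → unitInterval) (G : SimpleGraph (Fin n)) :
    0 ≤ edgeProduct w G := by
  refine Finset.prod_nonneg fun e _ => ?_
  have := (w e).2
  split_ifs
  · exact this.1
  · linarith [this.2]

lemma integral_independentEdges (w : Pair n → unitInterval) (f : SimpleGraph (Fin n) → ℝ) :
    ∫ G, f G ∂independentEdges w = ∑ G, edgeProduct w G * f G := by
  rw [independentEdges, integral_finsetSum_measure]
  · refine Finset.sum_congr rfl fun G _ => ?_
    rw [integral_smul_measure, integral_dirac, ENNReal.toReal_ofReal (edgeProduct_nonneg w G),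
      smul_eq_mul]
  · intro G _
    exact (integrable_dirac (by simp)).smul_measure ENNReal.ofReal_ne_top

lemma integral_prod_edgeIndicator (w : Pair n → unitInterval) (φ : Pair n → ℝ → ℝ) :
    ∫ G, ∏ e, φ e (edgeIndicator G e) ∂independentEdges w =
      ∏ e, (w e * φ e 1 + (1 - w e) * φ e 0) := by
  classical
  rw [integral_independentEdges, ← sum_graph_prod]
  refine Finset.sum_congr rfl fun G _ => ?_
  rw [edgeProduct, ← Finset.prod_mul_distrib]
  refine Finset.prod_congr rfl fun e _ => ?_
  rw [edgeIndicator]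
  split_ifs <;> rfl

/-- The Fourier characters of the null distribution with edge probability `p`. -/
noncomputable def character (p : ℝ) (S : Finset (Pair n)) (G : SimpleGraph (Fin n)) : ℝ :=
  ∏ e ∈ S, (edgeIndicator G e - p) / √(p * (1 - p))

lemma integral_character (w : Pair n → unitInterval) (p : ℝ) (S : Finset (Pair n)) :
    ∫ G, character p S G ∂independentEdges w = ∏ e ∈ S, (w e - p) / √(p * (1 - p)) := by
  classical
  have h := integral_prod_edgeIndicator w
    fun e x => if e ∈ S then (x - p) / √(p * (1 - p)) else 1
  simp only [Finset.prod_ite_mem, Finset.univ_inter] at h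
  simp only [character, h]
  rw [← Finset.univ_inter S, ← Finset.prod_ite_mem]
  refine Finset.prod_congr rfl fun e _ => ?_
  simp only [Finset.univ_inter]
  split_ifs <;> ring

lemma coe_toProb {x : ℝ} (h0 : 0 ≤ x) (h1 : x ≤ 1) : (toProb x : ℝ) = x := by
  rw [toProb, Set.projIcc_of_mem zero_le_one ⟨h0, h1⟩]

lemma integral_character_mul {d : ℝ} (h0 : 0 < d / n) (h1 : d / n < 1)
    (S T : Finset (Pair n)) [Decidable (S = T)] :
    ∫ G, character (d / n) S G * character (d / n) T G ∂null d n = if S = T then 1 else 0 := by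
  classical
  set p := d / n with hp
  have hs : √(p * (1 - p)) ^ 2 = p * (1 - p) := Real.sq_sqrt (by nlinarith)
  have hpos : 0 < p * (1 - p) := by nlinarith
  have hs0 : √(p * (1 - p)) ≠ 0 := (Real.sqrt_pos.mpr hpos).ne'
  have h := integral_prod_edgeIndicator (n := n) (fun _ => toProb p)
    fun e x => (if e ∈ S then (x - p) / √(p * (1 - p)) else 1) *
      (if e ∈ T then (x - p) / √(p * (1 - p)) else 1)
  simp only [Finset.prod_mul_distrib, Finset.prod_ite_mem, Finset.univ_inter] at h
  simp only [character, null, ← hp, h, coe_toProb h0.le h1.le]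
  -- An edge in both sets contributes its normalized variance `1`, an edge in neither contributes
  -- `1`, and an edge in exactly one contributes a centred mean `0`.
  have hfac : ∀ e : Pair n, (p * ((if e ∈ S then (1 - p) / √(p * (1 - p)) else 1) *
      (if e ∈ T then (1 - p) / √(p * (1 - p)) else 1)) +
      (1 - p) * ((if e ∈ S then (0 - p) / √(p * (1 - p)) else 1) *
      (if e ∈ T then (0 - p) / √(p * (1 - p)) else 1))) =
      if (e ∈ S ↔ e ∈ T) then 1 else 0 := by
    intro e
    by_cases hS : e ∈ S <;> by_cases hT : e ∈ T <;> simp only [hS, hT, if_true, if_false]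
    · field_simp
      rw [hs]; simp; ring
    all_goals simp
    all_goals field_simp
    all_goals ring
  simp only [hfac]
  split_ifs with hST
  · simp [hST]
  · obtain ⟨e, he⟩ : ∃ e, ¬ (e ∈ S ↔ e ∈ T) := by
      by_contra! hc
      exact hST (Finset.ext hc)
    exact Finset.prod_eq_zero (Finset.mem_univ e) (if_neg he)

lemma inner_toL2 (μ : Measure (SimpleGraph (Fin n))) [IsFiniteMeasure μ]
    (f g : SimpleGraph (Fin n) → ℝ) :
    inner ℝ (toL2 μ f) (toL2 μ g) = ∫ G, f G * g G ∂μ := by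
  rw [L2.inner_def]
  refine integral_congr_ae ?_
  have hf : toL2 μ f =ᵐ[μ] f := MemLp.coeFn_toLp MemLp.of_discrete
  have hg : toL2 μ g =ᵐ[μ] g := MemLp.coeFn_toLp MemLp.of_discrete
  filter_upwards [hf, hg] with G h1 h2
  rw [h1, h2]
  simp [mul_comm]

lemma orthonormal_character {d : ℝ} (h0 : 0 < d / n) (h1 : d / n < 1) :
    Orthonormal ℝ fun S : Finset (Pair n) => toL2 (null d n) (character (d / n) S) := by
  classical
  rw [orthonormal_iff_ite]
  intro S T
  rw [inner_toL2, integral_character_mul h0 h1]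

/-- Indicators are idempotent, so a monomial depends only on its support, whose size is at most the
degree. Writing each indicator as its centred part plus `p` and expanding gives characters of
subsets of the support. -/
lemma polyEval_mem_span {p : ℝ} (h0 : 0 < p) (h1 : p < 1) {D : ℕ} {q : MvPolynomial (Pair n) ℝ}
    (hq : q ∈ MvPolynomial.restrictTotalDegree (Pair n) ℝ D) :
    polyEval n q ∈ Submodule.span ℝ
      (character p '' ((Finset.univ.filter fun S : Finset (Pair n) => S.card ≤ D) :
        Set (Finset (Pair n)))) := by
  classical
  have hpos : 0 < √(p * (1 - p)) := Real.sqrt_pos.mpr (by nlinarith)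
  have hdeg := (MvPolynomial.mem_restrictTotalDegree _ _ _).mp hq
  rw [q.as_sum, map_sum]
  refine Submodule.sum_mem _ fun a ha => ?_
  have hcard : a.support.card ≤ D := by
    refine le_trans ?_ ((MvPolynomial.le_totalDegree ha).trans hdeg)
    rw [Finsupp.sum, Finset.card_eq_sum_ones]
    exact Finset.sum_le_sum fun e he => Nat.one_le_iff_ne_zero.mpr (Finsupp.mem_support_iff.mp he)
  have hmono : polyEval n (MvPolynomial.monomial a (MvPolynomial.coeff a q)) =
      ∑ T ∈ a.support.powerset, (MvPolynomial.coeff a q * (√(p * (1 - p)) ^ T.card *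
        p ^ (a.support \ T).card)) • character p T := by
    funext G
    simp only [polyEval, LinearMap.coe_mk, AddHom.coe_mk, MvPolynomial.eval_monomial,
      Finset.sum_apply, Pi.smul_apply, smul_eq_mul, mul_assoc, ← Finset.mul_sum]
    congr 1
    have h2 : a.prod (fun e i => edgeIndicator G e ^ i) = ∏ e ∈ a.support,
        (√(p * (1 - p)) * ((edgeIndicator G e - p) / √(p * (1 - p))) + p) := by
      refine Finset.prod_congr rfl fun e he => ?_
      rw [mul_div_cancel₀ _ hpos.ne', sub_add_cancel]
      have := Finsupp.mem_support_iff.mp he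
      by_cases h : G.Adj e.1.1 e.1.2 <;> simp [edgeIndicator, h, this]
    rw [h2, Finset.prod_add]
    refine Finset.sum_congr rfl fun T _ => ?_
    rw [Finset.prod_mul_distrib, Finset.prod_const, Finset.prod_const, character]
    ring
  rw [hmono]
  refine Submodule.sum_mem _ fun T hT => Submodule.smul_mem _ _ (Submodule.subset_span ?_)
  exact ⟨T, by simpa using (Finset.card_le_card (Finset.mem_powerset.mp hT)).trans hcard, rfl⟩

lemma lowDegree_le_span {d : ℝ} (h0 : 0 < d / n) (h1 : d / n < 1) (D : ℕ) :
    lowDegree (null d n) D ≤ Submodule.span ℝ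
      ((fun S : Finset (Pair n) => toL2 (null d n) (character (d / n) S)) ''
        ((Finset.univ.filter fun S : Finset (Pair n) => S.card ≤ D) :
          Set (Finset (Pair n)))) := by
  rw [lowDegree, ← Set.image_image (toL2 (null d n)), ← Submodule.map_span]
  refine Submodule.map_mono ?_
  rintro _ ⟨q, hq, rfl⟩
  exact polyEval_mem_span h0 h1 hq

lemma absolutelyContinuous_null {d : ℝ} (h0 : 0 < d / n) (h1 : d / n < 1)
    (μ : Measure (SimpleGraph (Fin n))) : μ ≪ null d n := by
  refine Measure.AbsolutelyContinuous.mk fun s _ hs => ?_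
  suffices s = ∅ by simp [this]
  by_contra hne
  obtain ⟨G, hG⟩ := Set.nonempty_iff_ne_empty.mpr hne
  rw [null, independentEdges, Measure.finsetSum_apply] at hs
  have h2 := (Finset.sum_eq_zero_iff.mp hs) G (Finset.mem_univ G)
  have h3 : 0 < edgeProduct (n := n) (fun _ => toProb (d / n)) G := by
    refine Finset.prod_pos fun e _ => ?_
    rw [coe_toProb h0.le h1.le]
    split_ifs
    · exact h0
    · linarith
  simp [hG] at h2
  exact absurd h2 (not_le.mpr h3)

lemma integral_planted (k : ℕ) (d η : ℝ) (f : SimpleGraph (Fin n) → ℝ) :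
    ∫ G, f G ∂planted k d η n =
      ((k : ℝ) ^ n)⁻¹ * ∑ σ : Fin n → Fin k, ∫ G, f G ∂plantedGiven k d η n σ := by
  rw [planted, integral_smul_measure, integral_finsetSum_measure]
  · simp
  · intro σ _
    exact (MemLp.of_discrete (p := 1) (μ := independentEdges _)).integrable le_rfl

instance (k : ℕ) (d η : ℝ) (σ : Fin n → Fin k) : IsFiniteMeasure (plantedGiven k d η n σ) :=
  inferInstanceAs (IsFiniteMeasure (independentEdges _))

lemma isFiniteMeasure_planted {k : ℕ} (hk : k ≠ 0) (d η : ℝ) :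
    IsFiniteMeasure (planted k d η n) := by
  refine ⟨?_⟩
  rw [planted, Measure.smul_apply, smul_eq_mul]
  refine ENNReal.mul_lt_top (ENNReal.inv_lt_top.mpr ?_) (measure_lt_top _ _)
  exact ENNReal.pow_pos (by exact_mod_cast Nat.pos_of_ne_zero hk) n

/-- The normalized excess edge probability `k 1[σ u = σ v] - 1` of the pair `(u, v)`. -/
def excess {k : ℕ} (σ : Fin n → Fin k) (e : Pair n) : ℝ :=
  if σ e.1.1 = σ e.1.2 then (k : ℝ) - 1 else -1

lemma integral_character_planted {k : ℕ} {d η : ℝ}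
    (ha : (1 + ((k : ℝ) - 1) * η) * d / n ∈ Set.Icc (0 : ℝ) 1)
    (hb : (1 - η) * d / n ∈ Set.Icc (0 : ℝ) 1) (S : Finset (Pair n)) :
    ∫ G, character (d / n) S G ∂planted k d η n = ((k : ℝ) ^ n)⁻¹ * ∑ σ : Fin n → Fin k,
      ∏ e ∈ S, (η * (d / n) / √(d / n * (1 - d / n)) * excess σ e) := by
  rw [integral_planted]
  congr 1
  refine Finset.sum_congr rfl fun σ _ => ?_
  rw [plantedGiven, integral_character]
  refine Finset.prod_congr rfl fun e _ => ?_
  rw [excess]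
  split_ifs
  · rw [coe_toProb ha.1 ha.2]; ring
  · rw [coe_toProb hb.1 hb.2]; ring

/-- Pairing a character with the likelihood ratio is a change of measure to the planted law, under
which the mean is an average of products over edges; the moment inequality then applies to the
squares. -/
lemma norm_lowDegreeLikelihoodRatio_sq_le {k : ℕ} (hk : k ≠ 0) {d η : ℝ}
    (h0 : 0 < d / n) (h1 : d / n < 1)
    (ha : (1 + ((k : ℝ) - 1) * η) * d / n ∈ Set.Icc (0 : ℝ) 1)
    (hb : (1 - η) * d / n ∈ Set.Icc (0 : ℝ) 1) (D : ℕ) :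
    ‖lowDegreeLikelihoodRatio k d η n D‖ ^ 2 ≤
      (((k : ℝ) ^ n)⁻¹) ^ 2 * ∑ σ : Fin n → Fin k, ∑ σ' : Fin n → Fin k,
        ∑ m ∈ Finset.range (D + 1),
          (η ^ 2 * (d / n) / (1 - d / n) * ∑ e, excess σ e * excess σ' e) ^ m /
            (m.factorial : ℝ) := by
  have := isFiniteMeasure_planted (n := n) hk d η
  refine (norm_starProjection_sq_le (orthonormal_character h0 h1) _
    (lowDegree_le_span h0 h1 D) _).trans ?_
  have hinner : ∀ S : Finset (Pair n),
      inner ℝ (toL2 (null d n) (character (d / n) S)) (likelihoodRatio k d η n) =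
        ((k : ℝ) ^ n)⁻¹ * ∑ σ : Fin n → Fin k,
          ∏ e ∈ S, (η * (d / n) / √(d / n * (1 - d / n)) * excess σ e) := by
    intro S
    rw [likelihoodRatio, inner_toL2, ← integral_character_planted ha hb,
      ← integral_toReal_rnDeriv_mul (absolutelyContinuous_null h0 h1 (planted k d η n))]
    exact integral_congr_ae (.of_forall fun G => mul_comm _ _)
  simp only [hinner, mul_pow (((k : ℝ) ^ n)⁻¹), ← Finset.mul_sum]
  refine mul_le_mul_of_nonneg_left ?_ (by positivity)
  refine (sum_card_le_prod_sq_le (fun (σ : Fin n → Fin k) e =>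
    η * (d / n) / √(d / n * (1 - d / n)) * excess σ e) D).trans (le_of_eq ?_)
  have hs : √(d / n * (1 - d / n)) ^ 2 = d / n * (1 - d / n) := Real.sq_sqrt (by nlinarith)
  have hc : (η * (d / n) / √(d / n * (1 - d / n))) ^ 2 = η ^ 2 * (d / n) / (1 - d / n) := by
    rw [div_pow, hs]
    have : 1 - d / n ≠ 0 := by linarith
    have := h0.ne'
    generalize d / (n : ℝ) = p at *
    field_simp
  refine Finset.sum_congr rfl fun σ _ => Finset.sum_congr rfl fun σ' _ =>
    Finset.sum_congr rfl fun m _ => ?_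
  rw [← hc, Finset.mul_sum]
  congr 2
  exact Finset.sum_congr rfl fun e _ => by ring

end Fourier

/-! ### Feature vectors of label pairs -/

section Features

variable {k : ℕ}

/-- The entries of the projection of `ℝ^k` to the complement of the constant vectors. -/
noncomputable def centering (x i : Fin k) : ℝ := (if x = i then 1 else 0) - 1 / (k : ℝ)

lemma centering_comm (x i : Fin k) : centering x i = centering i x := by
  simp only [centering, eq_comm]

lemma sum_centering (hk : k ≠ 0) (i : Fin k) : ∑ x, centering x i = 0 := by
  have : (k : ℝ) ≠ 0 := by exact_mod_cast hk
  simp [centering, this]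

lemma sum_centering_mul (hk : k ≠ 0) (i j : Fin k) :
    ∑ x, centering x i * centering x j = centering i j := by
  have h1 : ∑ x, centering x i * centering x j =
      ∑ x, (if x = i then centering x j else 0) - 1 / (k : ℝ) * ∑ x, centering x j := by
    rw [Finset.mul_sum, ← Finset.sum_sub_distrib]
    refine Finset.sum_congr rfl fun x _ => ?_
    rw [centering, sub_mul, ite_mul, one_mul, zero_mul]
  rw [h1, sum_centering hk]
  simp

lemma abs_centering_le (x i : Fin k) : |centering x i| ≤ 1 := by
  have hk : 1 ≤ (k : ℝ) := by exact_mod_cast x.pos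
  have h1 : 1 / (k : ℝ) ≤ 1 := by rw [div_le_one (by linarith)]; exact hk
  have h0 : 0 ≤ 1 / (k : ℝ) := by positivity
  rw [centering, abs_le]
  split_ifs <;> constructor <;> linarith

/-- The tensor square of `centering`. -/
noncomputable def centering₂ (a i : Fin k × Fin k) : ℝ := centering a.1 i.1 * centering a.2 i.2

lemma centering₂_comm (a i : Fin k × Fin k) : centering₂ a i = centering₂ i a := by
  rw [centering₂, centering₂, centering_comm, centering_comm a.2]

lemma sum_centering₂ (hk : k ≠ 0) (i : Fin k × Fin k) : ∑ a, centering₂ a i = 0 := by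
  simp only [centering₂, Fintype.sum_prod_type, ← Finset.mul_sum, sum_centering hk, mul_zero,
    Finset.sum_const_zero]

lemma sum_centering₂_mul (hk : k ≠ 0) (i j : Fin k × Fin k) :
    ∑ a, centering₂ a i * centering₂ a j = centering₂ i j := by
  rw [centering₂, ← sum_centering_mul hk, ← sum_centering_mul hk i.2, Fintype.sum_prod_type,
    Finset.sum_mul_sum]
  simp only [centering₂]
  exact Finset.sum_congr rfl fun x _ => Finset.sum_congr rfl fun y _ => by ring

lemma abs_centering₂_le (a i : Fin k × Fin k) : |centering₂ a i| ≤ 1 := by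
  rw [centering₂, abs_mul]
  exact mul_le_one₀ (abs_centering_le _ _) (abs_nonneg _) (abs_centering_le _ _)

/-- An orthogonal projection `P` is a contraction: `|P h|² = ⟪h, P h⟫ ≤ |h|² / 2 + |P h|² / 2`. -/
lemma sum_centering₂_sq_le (hk : k ≠ 0) (h : Fin k × Fin k → ℝ) :
    ∑ a, (∑ i, h i * centering₂ a i) ^ 2 ≤ ∑ i, h i ^ 2 := by
  have h1 : ∑ a, (∑ i, h i * centering₂ a i) ^ 2 = ∑ j, h j * ∑ i, h i * centering₂ j i := by
    simp only [pow_two, Finset.sum_mul_sum]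
    rw [Finset.sum_comm]
    simp only [Finset.mul_sum]
    rw [Finset.sum_congr rfl fun _ _ => Finset.sum_comm, Finset.sum_comm]
    rw [Finset.sum_comm]
    refine Finset.sum_congr rfl fun j _ => Finset.sum_congr rfl fun i _ => ?_
    rw [← sum_centering₂_mul hk, Finset.mul_sum, Finset.mul_sum]
    exact Finset.sum_congr rfl fun a _ => by ring
  have h2 : ∑ j, h j * ∑ i, h i * centering₂ j i ≤
      ∑ j, (1 / 2 * h j ^ 2 + 1 / 2 * (∑ i, h i * centering₂ j i) ^ 2) :=
    Finset.sum_le_sum fun j _ => by nlinarith [sq_nonneg (h j - ∑ i, h i * centering₂ j i)]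
  rw [Finset.sum_add_distrib, ← Finset.mul_sum, ← Finset.mul_sum] at h2
  linarith

/-- The standardized feature vector of a pair of labels. -/
noncomputable def labelFeature (a i : Fin k × Fin k) : ℝ := k * centering₂ a i

lemma sum_labelFeature (hk : k ≠ 0) (i : Fin k × Fin k) : ∑ a, labelFeature a i = 0 := by
  simp only [labelFeature, ← Finset.mul_sum, sum_centering₂ hk, mul_zero]

lemma sum_labelFeature_sq_le (hk : k ≠ 0) (h : Fin k × Fin k → ℝ) :
    ∑ a, (∑ i, h i * labelFeature a i) ^ 2 ≤ Fintype.card (Fin k × Fin k) * ∑ i, h i ^ 2 := by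
  have h1 : ∀ a, (∑ i, h i * labelFeature a i) ^ 2 =
      (k : ℝ) ^ 2 * (∑ i, h i * centering₂ a i) ^ 2 := by
    intro a
    rw [← mul_pow, Finset.mul_sum]
    congr 1
    exact Finset.sum_congr rfl fun i _ => by rw [labelFeature]; ring
  simp only [h1, ← Finset.mul_sum]
  rw [Fintype.card_prod, Fintype.card_fin, Nat.cast_mul, ← pow_two]
  exact mul_le_mul_of_nonneg_left (sum_centering₂_sq_le hk h) (by positivity)

lemma abs_labelFeature_le (a i : Fin k × Fin k) : |labelFeature a i| ≤ k := by
  rw [labelFeature, abs_mul, Nat.abs_cast]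
  exact mul_le_of_le_one_right (Nat.cast_nonneg _) (abs_centering₂_le a i)

lemma sum_labelFeature_mul (hk : k ≠ 0) (a b : Fin k × Fin k) :
    ∑ i, labelFeature a i * labelFeature b i = (k : ℝ) ^ 2 * centering₂ a b := by
  rw [← sum_centering₂_mul hk, Finset.mul_sum]
  refine Finset.sum_congr rfl fun i _ => ?_
  rw [labelFeature, labelFeature, centering₂_comm a, centering₂_comm b]
  ring

end Features

/-! ### The overlap as a quadratic form -/

section Overlap

variable {k n : ℕ}

lemma sum_symm_eq (f : Fin n → Fin n → ℝ) (hf : ∀ u v, f u v = f v u) :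
    ∑ u, ∑ v, f u v = ∑ u, f u u + 2 * ∑ e : Pair n, f e.1.1 e.1.2 := by
  have h1 : ∑ e : Pair n, f e.1.1 e.1.2 = ∑ u, ∑ v, if u < v then f u v else 0 := by
    rw [← Fintype.sum_prod_type', ← Finset.sum_filter]
    exact (Finset.sum_subtype (p := fun e : Fin n × Fin n => e.1 < e.2)
      (Finset.univ.filter fun e : Fin n × Fin n => e.1 < e.2) (by simp)
      (fun e => f e.1 e.2)).symm
  have h2 : ∑ u, ∑ v, (if u < v then f u v else 0) = ∑ u, ∑ v, if v < u then f u v else 0 := by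
    rw [Finset.sum_comm]
    simp only [hf]
  have h3 : ∑ u, f u u = ∑ u, ∑ v, if u = v then f u v else 0 := by simp
  rw [two_mul]
  nth_rewrite 2 [h1]
  rw [h1, h2, h3]
  nth_rewrite 1 [← h2]
  simp only [← Finset.sum_add_distrib]
  refine Finset.sum_congr rfl fun u _ => Finset.sum_congr rfl fun v _ => ?_
  rcases lt_trichotomy u v with h | h | h
  · simp [h, h.ne, h.asymm]
  · simp [h]
  · simp [h, h.ne', h.asymm]

lemma excess_mul_excess (hk : k ≠ 0) (τ : Fin n → Fin k × Fin k) (e : Pair n) :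
    excess (fun u => (τ u).1) e * excess (fun u => (τ u).2) e =
      (k : ℝ) ^ 2 * centering₂ (τ e.1.1) (τ e.1.2) := by
  have hk' : (k : ℝ) ≠ 0 := by exact_mod_cast hk
  have h : ∀ σ : Fin n → Fin k, excess σ e = k * centering (σ e.1.1) (σ e.1.2) := by
    intro σ
    rw [excess, centering]
    split_ifs <;> field_simp
    simp
  rw [h, h, centering₂]
  ring

/-- The feature vectors have Gram matrix `k ^ 2 * centering₂`, whose entry at a pair of vertices is
the product of the two excesses. Expanding the squared length separates the diagonal from twice the
sum over pairs. -/
lemma sum_wordSum_sq (hk : k ≠ 0) (τ : Fin n → Fin k × Fin k) :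
    ∑ i, wordSum labelFeature τ i ^ 2 = ∑ u, (k : ℝ) ^ 2 * centering₂ (τ u) (τ u) +
      2 * ∑ e, excess (fun u => (τ u).1) e * excess (fun u => (τ u).2) e := by
  simp only [excess_mul_excess hk]
  rw [← sum_symm_eq (fun u v => (k : ℝ) ^ 2 * centering₂ (τ u) (τ v))
    (fun u v => by rw [centering₂_comm])]
  simp only [← sum_labelFeature_mul hk, wordSum, pow_two (∑ u, _), Finset.sum_mul_sum]
  rw [Finset.sum_comm]
  exact Finset.sum_congr rfl fun u _ => Finset.sum_comm

lemma abs_sum_excess_le (hk : k ≠ 0) (τ : Fin n → Fin k × Fin k) :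
    |∑ e, excess (fun u => (τ u).1) e * excess (fun u => (τ u).2) e| ≤
      1 / 2 * ∑ i, wordSum labelFeature τ i ^ 2 + (k : ℝ) ^ 2 / 2 * n := by
  have h1 := sum_wordSum_sq hk τ
  have h2 : |∑ u, (k : ℝ) ^ 2 * centering₂ (τ u) (τ u)| ≤ (k : ℝ) ^ 2 * n := by
    refine (Finset.abs_sum_le_sum_abs _ _).trans ?_
    refine (Finset.sum_le_card_nsmul _ _ ((k : ℝ) ^ 2) fun u _ => ?_).trans
      (le_of_eq (by simp [mul_comm]))
    rw [abs_mul, abs_of_nonneg (by positivity)]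
    exact mul_le_of_le_one_right (by positivity) (abs_centering₂_le _ _)
  have h3 : 0 ≤ ∑ i, wordSum labelFeature τ i ^ 2 := by positivity
  rw [abs_le] at h2 ⊢
  constructor <;> linarith

lemma sum_wordSum_sq_le (τ : Fin n → Fin k × Fin k) :
    ∑ i, wordSum labelFeature τ i ^ 2 ≤ (k : ℝ) ^ 4 * (n : ℝ) ^ 2 := by
  have h1 : ∀ i, |wordSum labelFeature τ i| ≤ k * n := by
    intro i
    refine (Finset.abs_sum_le_sum_abs _ _).trans ?_
    exact (Finset.sum_le_card_nsmul _ _ (k : ℝ) fun u _ => abs_labelFeature_le _ _).trans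
      (le_of_eq (by simp [mul_comm]))
  refine (Finset.sum_le_card_nsmul _ _ (((k : ℝ) * n) ^ 2) fun i _ => ?_).trans
    (le_of_eq ?_)
  · rw [← sq_abs]
    exact pow_le_pow_left₀ (abs_nonneg _) (h1 i) 2
  · simp; ring

end Overlap

/-! ### Bounds on the truncated exponential series -/

section Truncation

lemma sum_pow_div_factorial_le_exp_abs (z : ℝ) (D : ℕ) :
    ∑ m ∈ Finset.range (D + 1), z ^ m / (m.factorial : ℝ) ≤ Real.exp |z| := by
  refine le_trans (Finset.sum_le_sum fun m _ => ?_)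
    (Real.sum_le_exp_of_nonneg (abs_nonneg z) (D + 1))
  refine div_le_div_of_nonneg_right ?_ (by positivity)
  rw [← abs_pow]
  exact le_abs_self _

lemma sum_pow_div_factorial_le {z B : ℝ} (hB : 1 ≤ B) (hz : |z| ≤ B) (D : ℕ) :
    ∑ m ∈ Finset.range (D + 1), z ^ m / (m.factorial : ℝ) ≤ (2 * B) ^ D := by
  have h1 : ∀ m ∈ Finset.range (D + 1), z ^ m / (m.factorial : ℝ) ≤ B ^ D := by
    intro m hm
    have hm' : m ≤ D := Nat.lt_succ_iff.mp (Finset.mem_range.mp hm)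
    calc z ^ m / (m.factorial : ℝ) ≤ |z| ^ m / (m.factorial : ℝ) := by
          refine div_le_div_of_nonneg_right ?_ (by positivity)
          rw [← abs_pow]
          exact le_abs_self _
      _ ≤ |z| ^ m := div_le_self (by positivity)
          (by exact_mod_cast Nat.succ_le_of_lt m.factorial_pos)
      _ ≤ B ^ m := by gcongr
      _ ≤ B ^ D := pow_le_pow_right₀ hB hm'
  refine (Finset.sum_le_card_nsmul _ _ _ h1).trans ?_
  rw [Finset.card_range, nsmul_eq_mul, mul_pow]
  gcongr
  exact_mod_cast Nat.lt_two_pow_self (n := D)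

/-- Once `n ≥ K`, the left side is at most `n ^ (2 * D n) = exp (2 * D n * log n)`, and `D n * log n
= o(n)`. -/
lemma eventually_pow_le_exp {D : ℕ → ℕ}
    (hD : (fun n : ℕ => (D n : ℝ)) =o[atTop] fun n : ℕ => (n : ℝ) / Real.log n)
    {K c : ℝ} (hK : 0 < K) (hc : 0 < c) :
    ∀ᶠ n : ℕ in atTop, (K * n) ^ D n ≤ Real.exp (c * n) := by
  filter_upwards [hD.def (half_pos hc), tendsto_natCast_atTop_atTop.eventually_ge_atTop K,
    eventually_ge_atTop 2] with n h1 h2 h3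
  have hn : (2 : ℝ) ≤ n := by exact_mod_cast h3
  have hlog : 0 < Real.log n := Real.log_pos (by linarith)
  rw [Real.norm_natCast, Real.norm_of_nonneg (by positivity)] at h1
  have hK2 : K * n ≤ (n : ℝ) ^ 2 := by rw [pow_two]; gcongr
  calc (K * n) ^ D n ≤ ((n : ℝ) ^ 2) ^ D n := by gcongr
    _ = Real.exp (D n * (2 * Real.log n)) := by
        rw [mul_comm, Real.exp_mul, Real.rpow_natCast, two_mul, Real.exp_add,
          Real.exp_log (by linarith), pow_two]
    _ ≤ Real.exp (c / 2 * (n / Real.log n) * (2 * Real.log n)) := by gcongr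
    _ = Real.exp (c * n) := by congr 1; field_simp

end Truncation

/-! ### Assembly of the bound -/

section Main

lemma eventually_norm_lowDegreeLikelihoodRatio_sq_le {k : ℕ} (hk : 2 ≤ k) {d η : ℝ}
    (hd : 0 < d) (hη : η ∈ Set.Icc (-1 / ((k : ℝ) - 1)) 1) (hKS : d * η ^ 2 < 1) {D : ℕ → ℕ}
    (hD : (fun n : ℕ => (D n : ℝ)) =o[atTop] fun n : ℕ => (n : ℝ) / Real.log n) :
    ∃ C : ℝ, ∀ᶠ n : ℕ in atTop, ‖lowDegreeLikelihoodRatio k d η n (D n)‖ ^ 2 ≤ C := by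
  have hk0 : k ≠ 0 := by omega
  have hkR : (2 : ℝ) ≤ k := by exact_mod_cast hk
  -- The midpoint between `d * η ^ 2` and `1` leaves room on both sides: `lam * n ≤ θ` for large
  -- `n`, and with `δ = 1 - θ` one has `(1 + δ) * θ = 1 - (1 - θ) ^ 2 < 1`.
  set θ : ℝ := (1 + d * η ^ 2) / 2 with hθ
  have hdη : 0 ≤ d * η ^ 2 := by positivity
  have hθ0 : 0 < θ := by rw [hθ]; linarith
  have hθ1 : θ < 1 := by rw [hθ]; linarith
  have hδ : (1 + (1 - θ)) * θ < 1 := by nlinarith [sq_pos_of_pos (sub_pos.mpr hθ1)]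
  obtain ⟨ρ, hρ, hY⟩ := exists_sum_exp_le (labelFeature (k := k)) (sum_labelFeature hk0)
    (sum_labelFeature_sq_le hk0) (sub_pos.mpr hθ1)
  obtain ⟨C, hC⟩ := exists_sum_exp_sq_wordSum_le _ hθ0 hθ1.le hρ hδ hY
  have hlarge := exists_card_large_wordSum_le (labelFeature (k := k)) (by linarith)
    (half_pos hρ) (half_le_self hρ.le) hY
  set A : ℝ := (Fintype.card (Fin k × Fin k) : ℝ) with hA
  have hAk : A = (k : ℝ) ^ 2 := by rw [hA]; simp [pow_two]
  have hk4 : (1 : ℝ) ≤ (k : ℝ) ^ 4 := one_le_pow₀ (by linarith)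
  refine ⟨Real.exp (k ^ 2 / 2) * C + 2 * A, ?_⟩
  have hnlim : Tendsto (fun n : ℕ => (n : ℝ)) atTop atTop := tendsto_natCast_atTop_atTop
  -- The rate `(ρ / 2) ^ 2 / 4` is the Chernoff rate at `ε = ρ / 2`, so growth and decay cancel on
  -- the bad words. The last threshold on `n` is what `η ^ 2 * d / (n - d) ≤ θ / n` requires.
  filter_upwards [hC, eventually_pow_le_exp hD (K := 2 * (k : ℝ) ^ 4) (by positivity)
      (c := (ρ / 2) ^ 2 / 4) (by positivity), hnlim.eventually_gt_atTop d,
      hnlim.eventually_ge_atTop ((1 + ((k : ℝ) - 1) * η) * d),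
      hnlim.eventually_ge_atTop ((1 - η) * d), hnlim.eventually_ge_atTop 1,
      hnlim.eventually_ge_atTop (θ * d / (θ - d * η ^ 2))] with n hCn hDn hn1 hn2 hn3 hn4 hn5
  have hn0 : (0 : ℝ) < n := by linarith
  have hη1 : 0 ≤ 1 + ((k : ℝ) - 1) * η := by
    have := hη.1
    rw [div_le_iff₀ (by linarith)] at this
    linarith
  have hη2 : 0 ≤ 1 - η := by linarith [hη.2]
  refine (norm_lowDegreeLikelihoodRatio_sq_le hk0 (div_pos hd hn0)
    ((div_lt_one hn0).mpr hn1) ⟨by positivity, (div_le_one hn0).mpr hn2⟩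
    ⟨by positivity, (div_le_one hn0).mpr hn3⟩ (D n)).trans ?_
  set lam : ℝ := η ^ 2 * (d / n) / (1 - d / n) with hlam
  have hlam0 : 0 ≤ lam :=
    div_nonneg (by positivity) (by linarith [(div_lt_one hn0).mpr hn1])
  have hlam1 : lam ≤ θ / n := by
    have e1 : lam = η ^ 2 * d / (n - d) := by
      rw [hlam]
      have : (n : ℝ) - d ≠ 0 := by linarith
      field_simp
    rw [e1, div_le_div_iff₀ (by linarith) hn0]
    rw [div_le_iff₀ (by rw [hθ]; linarith)] at hn5
    linarith
  set W : (Fin n → Fin k × Fin k) → ℝ := fun τ =>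
    lam * ∑ e, excess (fun u => (τ u).1) e * excess (fun u => (τ u).2) e with hW
  set T : (Fin n → Fin k × Fin k) → ℝ := fun τ =>
    ∑ m ∈ Finset.range (D n + 1), W τ ^ m / (m.factorial : ℝ) with hT
  have hWabs : ∀ τ, |W τ| ≤
      θ / (2 * n) * ∑ i, wordSum labelFeature τ i ^ 2 + (k : ℝ) ^ 2 / 2 := by
    intro τ
    rw [hW]
    simp only [abs_mul, abs_of_nonneg hlam0]
    refine (mul_le_mul hlam1 (abs_sum_excess_le hk0 τ) (abs_nonneg _) (by positivity)).trans ?_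
    have e2 : θ / n * (1 / 2 * ∑ i, wordSum labelFeature τ i ^ 2 + (k : ℝ) ^ 2 / 2 * n) =
      θ / (2 * n) * ∑ i, wordSum labelFeature τ i ^ 2 + θ * ((k : ℝ) ^ 2 / 2) := by
      field_simp
    rw [e2]
    gcongr
    exact mul_le_of_le_one_left (by positivity) hθ1.le
  have hWle : ∀ τ, |W τ| ≤ (k : ℝ) ^ 4 * n := by
    intro τ
    refine (hWabs τ).trans ?_
    have e3 : θ / (2 * n) * ∑ i, wordSum labelFeature τ i ^ 2 ≤
        1 / (2 * n) * ((k : ℝ) ^ 4 * (n : ℝ) ^ 2) := by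
      gcongr
      exact sum_wordSum_sq_le τ
    have e4 : 1 / (2 * n) * ((k : ℝ) ^ 4 * (n : ℝ) ^ 2) = (k : ℝ) ^ 4 * n / 2 := by field_simp
    have e5 : (k : ℝ) ^ 2 ≤ (k : ℝ) ^ 4 * n :=
      (pow_le_pow_right₀ (by linarith) (by norm_num)).trans
        (le_mul_of_one_le_right (by positivity) hn4)
    linarith
  have hsum : ∑ σ : Fin n → Fin k, ∑ σ' : Fin n → Fin k, ∑ m ∈ Finset.range (D n + 1),
      (lam * ∑ e, excess σ e * excess σ' e) ^ m / (m.factorial : ℝ) = ∑ τ, T τ := by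
    -- A pair of labellings is the same as one word in pairs of labels.
    rw [← Fintype.sum_prod_type']
    exact Fintype.sum_equiv (Equiv.arrowProdEquivProdArrow (Fin n) (fun _ => Fin k)
      (fun _ => Fin k)).symm _ _ fun _ => rfl
  have hgood : ∑ τ with ∀ i, |wordSum labelFeature τ i| ≤ ρ / 2 * n, T τ ≤
      Real.exp (k ^ 2 / 2) * (C * A ^ n) := by
    refine le_trans ?_ (mul_le_mul_of_nonneg_left hCn (Real.exp_pos _).le)
    rw [Finset.mul_sum]
    refine Finset.sum_le_sum fun τ _ => (sum_pow_div_factorial_le_exp_abs _ _).trans ?_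
    rw [← Real.exp_add, Real.exp_le_exp]
    linarith [hWabs τ]
  have hbad : ∑ τ with ¬ ∀ i, |wordSum labelFeature τ i| ≤ ρ / 2 * n, T τ ≤
      2 * A * A ^ n := by
    rw [mul_assoc] at hDn
    refine (Finset.sum_le_card_nsmul _ _ _ fun τ _ => (sum_pow_div_factorial_le
      (by nlinarith) (hWle τ) (D n)).trans hDn).trans ?_
    rw [nsmul_eq_mul]
    refine (mul_le_mul_of_nonneg_right (hlarge n) (Real.exp_pos _).le).trans (le_of_eq ?_)
    have e6 : Real.exp (-((ρ / 2) ^ 2 / 4) * n) * Real.exp ((ρ / 2) ^ 2 / 4 * n) = 1 := by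
      rw [← Real.exp_add, neg_mul, neg_add_cancel, Real.exp_zero]
    calc _ = 2 * A * A ^ n *
        (Real.exp (-((ρ / 2) ^ 2 / 4) * n) * Real.exp ((ρ / 2) ^ 2 / 4 * n)) := by ring
      _ = _ := by rw [e6, mul_one]
  rw [hsum, ← Finset.sum_filter_add_sum_filter_not _
    (fun τ => ∀ i, |wordSum labelFeature τ i| ≤ ρ / 2 * n)]
  have hAn : (((k : ℝ) ^ n)⁻¹) ^ 2 * A ^ n = 1 := by
    rw [hAk, inv_pow, ← pow_mul, ← pow_mul, mul_comm n 2, inv_mul_cancel₀ (by positivity)]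
  calc _ ≤ (((k : ℝ) ^ n)⁻¹) ^ 2 *
        (Real.exp (k ^ 2 / 2) * (C * A ^ n) + 2 * A * A ^ n) := by
        gcongr
    _ = (((k : ℝ) ^ n)⁻¹) ^ 2 * A ^ n * (Real.exp (k ^ 2 / 2) * C + 2 * A) := by ring
    _ = _ := by rw [hAn, one_mul]

end Main

end SBM

theorem theorem4p9 (k : ℕ) (hk : 2 ≤ k) (d η : ℝ) (hd : 0 < d)
    (hη : η ∈ Set.Icc (-1 / ((k : ℝ) - 1)) 1) (hKS : d * η ^ 2 < 1)
    (D : ℕ → ℕ)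
    (hD : (fun n : ℕ => (D n : ℝ)) =o[atTop] fun n : ℕ => (n : ℝ) / Real.log n) :
    (fun n : ℕ => ‖SBM.lowDegreeLikelihoodRatio k d η n (D n)‖) =O[atTop]
      fun _ : ℕ => (1 : ℝ) := by
  obtain ⟨C, hC⟩ := SBM.eventually_norm_lowDegreeLikelihoodRatio_sq_le hk hd hη hKS hD
  refine IsBigO.of_bound √C ?_
  filter_upwards [hC] with n hn
  rw [norm_norm, norm_one, mul_one]
  exact Real.le_sqrt_of_sq_le hn
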